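/- Let $\lambda$ be Lebesgue measure on $\{0,1\}^{\mathbb N}$. A Martin-Löf test is a computable sequence $(U_n)_{n\in\mathbb N}$ of open subsets of $\{0,1\}^{\mathbb N}$ with $\lambda(U_n)\le 2^{-n}$; it is universal if $\bigcap_n V_n\subseteq\bigcap_n U_n$ for every Martin-Löf test $(V_n)_{n\in\mathbb N}$. The set $\mathrm{MLR}:=\{0,1\}^{\mathbb N}\setminus\bigcap_n U_n$ of random sequences is the same for every universal test. For a universal Martin-Löf test $\mathcal U=(U_n)_{n\in\mathbb N}$, let $\mathrm{LAY}_{\mathcal U}:\mathrm{MLR}\rightrightarrows\mathbb N$ be the multivalued function with $n\in\mathrm{LAY}_{\mathcal U}(p)$ iff $p\notin U_n$. For multivalued functions $f,g$ on represented spaces, write $f\le_{\mathrm W}g$ if there are computable partial functions $K,H:\subseteq\mathbb N^{\mathbb N}\to\mathbb N^{\mathbb N}$ such that $p\mapsto K\langle p,GH(p)\rangle$ is a realizer of $f$ for every realizer $G$ of $g$, and $f\equiv_{\mathrm W}g$ if $f\le_{\mathrm W}g$ and $g\le_{\mathrm W}f$. Let $(f\times g)(x,y)=f(x)\times g(y)$,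 and let $f\star g$ be the compositional product, that is, the maximum with respect to $\le_{\mathrm W}$ (determined up to $\equiv_{\mathrm W}$) of all compositions $f_0\circ g_0$ of composable multivalued functions on represented spaces with $f_0\le_{\mathrm W}f$ and $g_0\le_{\mathrm W}g$; here $\operatorname{dom}(f_0\circ g_0)=\{x\in\operatorname{dom}(g_0) : g_0(x)\subseteq\operatorname{dom}(f_0)\}$. Then, for any universal Martin-Löf tests $\mathcal U,\mathcal V,\mathcal W$, $$\mathrm{LAY}_{\mathcal U}\times\mathrm{LAY}_{\mathcal V}\equiv_{\mathrm W}\mathrm{LAY}_{\mathcal W},$$ and the compositional product $\mathrm{LAY}_{\mathcal U}\star\mathrm{LAY}_{\mathcal V}$ exists and satisfies $$\mathrm{LAY}_{\mathcal U}\star\mathrm{LAY}_{\mathcal V}\equiv_{\mathrm W}\mathrm{LAY}_{\mathcal W}.$$ In particular (taking $\mathcal U=\mathcal V=\mathcal W$), $\mathrm{LAY}\times\mathrm{LAY}\equiv_{\mathrm W}\mathrm{LAY}$ and $\mathrm{LAY}\star\mathrm{LAY}\equiv_{\mathrm W}\mathrm{LAY}$. -/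

import Mathlib

open scoped ENNReal

namespace Weihrauch

/-! ### Computability on Baire space -/

/-- Baire space. -/
abbrev Baire : Type := ℕ → ℕ

/-- Cantor space. -/
abbrev Cantor : Type := ℕ → Bool

/-- The finite prefix of `p` of length `n`. -/
def initSeg {α : Type} (p : ℕ → α) (n : ℕ) : List α := (List.range n).map p

/-- Type-2 computability of a partial function on Baire space: some computable map `h` on finite
words, monotone for the prefix order, produces from longer and longer prefixes of `p ∈ dom F`
longer and longer prefixes of `F p` (`h w` is the output that the machine has written after `|w|`
steps on the input prefix `w`). By monotonicity, all the words `h (initSeg p m)` are then prefixes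
of `F p`. -/
def IsComputable (F : Baire →. Baire) : Prop :=
  ∃ h : List ℕ → List ℕ, Computable h ∧ (∀ v w, v <+: w → h v <+: h w) ∧
    ∀ p q, q ∈ F p → ∀ k, ∃ m, initSeg q k <+: h (initSeg p m)

/-- The standard pairing `⟨p, q⟩ = p 0, q 0, p 1, q 1, …` on Baire space. -/
def pair (p q : Baire) : Baire := fun n => if n % 2 = 0 then p (n / 2) else q (n / 2)

/-- The first component of the pairing. -/
def fst (r : Baire) : Baire := fun n => r (2 * n)

/-- The second component of the pairing. -/
def snd (r : Baire) : Baire := fun n => r (2 * n + 1)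

theorem fst_pair (p q : Baire) : fst (pair p q) = p := by
  funext n; simp [fst, pair]

theorem snd_pair (p q : Baire) : snd (pair p q) = q := by
  funext n
  have h1 : (2 * n + 1) % 2 = 1 := by omega
  have h2 : (2 * n + 1) / 2 = n := by omega
  simp [snd, pair, h1, h2]

/-! ### Represented spaces and multivalued functions -/

/-- A represented space: a set with a partial surjection `δ` from Baire space onto it. (Such a set
has at most the cardinality of the continuum, so that `Type` loses no represented space.) -/
structure RepSpace where
  carrier : Type
  δ : Baire →. carrier
  surj : ∀ x, ∃ p, x ∈ δ p

/-- Cantor space, represented as a subspace of Baire space: a name of `x` is `x` itself, as a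
sequence of zeros and ones. -/
abbrev cantorSpace : RepSpace where
  carrier := Cantor
  δ := fun p => ⟨∀ n, p n ≤ 1, fun _ n => decide (p n = 1)⟩
  surj := fun x => ⟨fun n => (x n).toNat, fun n => Bool.toNat_le (x n), by
    funext n; cases h : x n <;> simp [h]⟩

/-- The natural numbers, where `p` is a name of `p 0`. -/
abbrev natSpace : RepSpace where
  carrier := ℕ
  δ := fun p => Part.some (p 0)
  surj := fun n => ⟨fun _ => n, by simp⟩

/-- The product of two represented spaces: `⟨p, q⟩` is a name of `(x, y)` if `p` is one of `x` and
`q` is one of `y`. -/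
def RepSpace.prod (X Y : RepSpace) : RepSpace where
  carrier := X.carrier × Y.carrier
  δ := fun r => (X.δ (fst r)).bind fun x => (Y.δ (snd r)).map fun y => (x, y)
  surj := by
    rintro ⟨x, y⟩
    obtain ⟨p, hp⟩ := X.surj x
    obtain ⟨q, hq⟩ := Y.surj y
    exact ⟨pair p q, by simpa [fst_pair, snd_pair] using ⟨hp, hq⟩⟩

/-- A partial multivalued function `f : ⊆ X ⇉ Y`, given by its sets of values; its domain is the
set of points where this set is non-empty. -/
def Problem (X Y : RepSpace) : Type := X.carrier → Set Y.carrier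

/-- The domain of a multivalued function. -/
def Problem.dom {X Y : RepSpace} (f : Problem X Y) : Set X.carrier := {x | (f x).Nonempty}

/-- `F` is a realizer of `f`: it maps every name of a point of `dom f` to a name of a value. -/
def Realizes {X Y : RepSpace} (F : Baire →. Baire) (f : Problem X Y) : Prop :=
  ∀ p x, x ∈ X.δ p → x ∈ f.dom → ∃ q ∈ F p, ∃ y ∈ Y.δ q, y ∈ f x

/-- Weihrauch reducibility: there are computable `K, H` such that `p ↦ K ⟨p, G (H p)⟩` realizes
`f` whenever `G` realizes `g`. -/
def Le {X Y Z W : RepSpace} (f : Problem X Y) (g : Problem Z W) : Prop :=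
  ∃ K H : Baire →. Baire, IsComputable K ∧ IsComputable H ∧
    ∀ G : Baire →. Baire, Realizes G g →
      Realizes (fun p => (H p).bind fun a => (G a).bind fun b => K (pair p b)) f

/-- Weihrauch equivalence. -/
def Equivalent {X Y Z W : RepSpace} (f : Problem X Y) (g : Problem Z W) : Prop :=
  Le f g ∧ Le g f

/-- The parallel product `f × g`. -/
def Problem.prod {X Y Z W : RepSpace} (f : Problem X Y) (g : Problem Z W) :
    Problem (X.prod Z) (Y.prod W) :=
  fun x => f x.1 ×ˢ g x.2

/-- The composition `f ∘ g` of multivalued functions, whose domain consists of the `x ∈ dom g` with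
`g x ⊆ dom f`. -/
def Problem.comp {X Y Z : RepSpace} (f : Problem Y Z) (g : Problem X Y) : Problem X Z :=
  fun x => {z | g x ⊆ f.dom ∧ ∃ y ∈ g x, z ∈ f y}

/-- `h` is a representative of the Weihrauch degree `f ⋆ g`, the compositional product, which is the
maximum of the degrees of the compositions `f₀ ∘ g₀` over all composable `f₀` and `g₀` with
`f₀ ≤ f` and `g₀ ≤ g` in the Weihrauch order. -/
def IsCompProd {X Y Z W A B : RepSpace}
    (f : Problem X Y) (g : Problem Z W) (h : Problem A B) : Prop :=
  (∃ (R S T : RepSpace) (f₀ : Problem S T) (g₀ : Problem R S),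
    Le f₀ f ∧ Le g₀ g ∧ Equivalent h (f₀.comp g₀)) ∧
  ∀ (R S T : RepSpace) (f₀ : Problem S T) (g₀ : Problem R S),
    Le f₀ f → Le g₀ g → Le (f₀.comp g₀) h

/-! ### Martin-Löf tests -/

/-- The cylinder of all sequences with prefix `w`. -/
def cylinder (w : List Bool) : Set Cantor := {p | initSeg p w.length = w}

/-- A computable sequence of open sets: the `U i` are, uniformly in `i`, unions of computably listed
cylinders. The list of cylinders of `U i` may be finite or empty: `f i k = none` lists nothing. -/
def IsComputableOpenSeq (U : ℕ → Set Cantor) : Prop :=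
  ∃ f : ℕ → ℕ → Option (List Bool), Computable₂ f ∧
    ∀ i, U i = ⋃ (k : ℕ) (w ∈ f i k), cylinder w

/-- Lebesgue measure on Cantor space: the product of fair coin measures. -/
noncomputable def lebesgue : MeasureTheory.Measure Cantor :=
  MeasureTheory.Measure.infinitePi fun _ : ℕ => (PMF.uniformOfFintype Bool).toMeasure

/-- Martin-Löf tests (not necessarily nested). -/
def IsMLTest (U : ℕ → Set Cantor) : Prop :=
  IsComputableOpenSeq U ∧ ∀ i, lebesgue (U i) ≤ (2⁻¹ : ℝ≥0∞) ^ i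

/-- Universal Martin-Löf tests. -/
def IsUniversalMLTest (U : ℕ → Set Cantor) : Prop :=
  IsMLTest U ∧ ∀ V : ℕ → Set Cantor, IsMLTest V → ⋂ i, V i ⊆ ⋂ i, U i

/-- The set `MLR` of random sequences, read off a universal test `U`. -/
def MLR (U : ℕ → Set Cantor) : Set Cantor := (⋂ i, U i)ᶜ

/-- The problem `LAY_U : MLR ⇉ ℕ`, where `n ∈ LAY_U p` iff `p ∉ U n`, as a partial multivalued
function on Cantor space with domain `MLR`. -/
def LAY (U : ℕ → Set Cantor) : Problem cantorSpace natSpace :=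
  fun p => {n : ℕ | p ∉ U n}

theorem dom_LAY (U : ℕ → Set Cantor) : (LAY U).dom = MLR U := by
  refine Set.ext fun p => ?_
  have h : p ∈ (LAY U).dom ↔ ∃ n, p ∉ U n := Iff.rfl
  have h' : p ∈ MLR U ↔ ∃ n, p ∉ U n := by simp [MLR]
  exact h.trans h'.symm

end Weihrauch

namespace Weihrauch

/-! The core is that every composition `f₀ ∘ g₀` with both factors below `LAY` is itself below `LAY`
(`comp_le_LAY`); the other claims are soft consequences. An instance of `g₀` computes a random `z`.
The least layer avoiding `z` can be guessed in the limit (`layerGuess`). From this guess one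
computes the instance of `f₀`, hence a second random sequence, whose layer is guessed in the same
way. So the pair of layers is found with finitely many mind changes, and `le_LAY_of_limit` shows
that one call of `LAY W` is enough for such a problem, provided that the instance computes some
random sequence. That call works as follows. One starts to write `z`. Whenever the guess changes at
stage `s`, the word written so far is extended into `W 0, …, W s`, which is possible because `v000…`
is not random and so lies in every set of a universal test; then `z` is started afresh behind it. In
the end the query is a finite word followed by `z`, hence random. If `n` is an answer, the query
avoids `W n`, so no change occurs after stage `n`, and the guess of stage `n` is the final one. -/

open MeasureTheory Filter

/-! ### Invariance of randomness under finite prefixes -/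

/-- Prepend a bit to a sequence. -/
def consBit (b : Bool) (a : Cantor) : Cantor := fun n => Nat.casesOn n b a

theorem measurable_consBit (b : Bool) : Measurable (consBit b) := by
  refine measurable_pi_lambda _ fun n => ?_
  cases n with
  | zero => exact measurable_const
  | succ n => exact measurable_pi_apply n

theorem coin_eq (t : Set Bool) : (PMF.uniformOfFintype Bool).toMeasure t =
    2⁻¹ * t.indicator 1 false + 2⁻¹ * t.indicator 1 true := by
  rw [PMF.toMeasure_apply_fintype, Fintype.sum_bool, add_comm]
  classical
  simp [Set.indicator_apply]

/-- A product measure is determined by its values on finite boxes. Conditioning on coordinate 0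
splits a box into its factor there and the shifted box. -/
theorem lebesgue_eq_map_consBit :
    (2⁻¹ : ℝ≥0∞) • lebesgue.map (consBit false) + (2⁻¹ : ℝ≥0∞) • lebesgue.map (consBit true)
      = lebesgue := by
  refine Measure.eq_infinitePi _ fun s t ht => ?_
  -- Padding with full factors, of measure 1, makes the index set an initial segment, so that
  -- coordinate 0 can be split off.
  set t' : ℕ → Set Bool := fun i => if i ∈ s then t i else Set.univ with ht'
  obtain ⟨n, hn⟩ : ∃ n, s ⊆ Finset.range (n + 1) :=
    ⟨s.sup id, fun i hi => Finset.mem_range_succ_iff.2 (Finset.le_sup (f := id) hi)⟩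
  have hm : ∀ i, MeasurableSet (t' i) := fun i => MeasurableSet.of_discrete
  have hset : (s : Set ℕ).pi t = (Finset.range (n + 1) : Set ℕ).pi t' := by
    ext a
    simp only [Set.mem_pi, ht']
    refine ⟨fun h i _ => ?_, fun h i hi => ?_⟩
    · split_ifs with his
      · exact h i his
      · trivial
    · simpa [Finset.mem_coe.1 hi] using h i (hn hi)
  have hprod : ∏ i ∈ s, (PMF.uniformOfFintype Bool).toMeasure (t i) =
      ∏ i ∈ Finset.range (n + 1), (PMF.uniformOfFintype Bool).toMeasure (t' i) := by
    rw [← Finset.prod_subset hn]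
    · exact Finset.prod_congr rfl fun i hi => by simp [ht', hi]
    · intro i _ hi
      simp only [ht', hi, if_false, measure_univ]
  have hpre : ∀ b, lebesgue (consBit b ⁻¹' (Finset.range (n + 1) : Set ℕ).pi t') =
      (t' 0).indicator 1 b *
        ∏ i ∈ Finset.range n, (PMF.uniformOfFintype Bool).toMeasure (t' (i + 1)) := by
    intro b
    by_cases hb : b ∈ t' 0
    · have : consBit b ⁻¹' (Finset.range (n + 1) : Set ℕ).pi t' =
          (Finset.range n : Set ℕ).pi fun i => t' (i + 1) := by
        ext a
        simp only [Set.mem_preimage, Set.mem_pi, Finset.coe_range, Set.mem_Iio]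
        refine ⟨fun h i hi => h (i + 1) (by omega), fun h i hi => ?_⟩
        cases i with
        | zero => exact hb
        | succ i => exact h i (by omega)
      rw [this, lebesgue, Measure.infinitePi_pi _ fun i _ => hm _]
      simp [hb]
    · have : consBit b ⁻¹' (Finset.range (n + 1) : Set ℕ).pi t' = ∅ := by
        ext a
        simp only [Set.mem_preimage, Set.mem_pi, Set.mem_empty_iff_false, iff_false]
        exact fun h => hb (h 0 (by simp))
      rw [this]
      simp [hb]
  have hms : MeasurableSet ((Finset.range (n + 1) : Set ℕ).pi t') :=
    MeasurableSet.pi (Finset.countable_toSet _) fun i _ => hm i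
  rw [hset, hprod, Measure.add_apply, Measure.smul_apply, Measure.smul_apply,
    Measure.map_apply (measurable_consBit _) hms, Measure.map_apply (measurable_consBit _) hms,
    hpre, hpre, Finset.prod_range_succ', coin_eq (t' 0)]
  simp only [smul_eq_mul]
  ring

theorem lebesgue_preimage_consBit_le (b : Bool) (A : Set Cantor) :
    lebesgue (consBit b ⁻¹' A) ≤ 2 * lebesgue A := by
  have h : (2⁻¹ : ℝ≥0∞) * lebesgue (consBit b ⁻¹' A) ≤ lebesgue A := by
    calc (2⁻¹ : ℝ≥0∞) * lebesgue (consBit b ⁻¹' A)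
        ≤ 2⁻¹ * lebesgue.map (consBit b) A := by
          gcongr 2⁻¹ * ?_; exact Measure.le_map_apply (measurable_consBit b).aemeasurable A
      _ ≤ ((2⁻¹ : ℝ≥0∞) • lebesgue.map (consBit false) +
            (2⁻¹ : ℝ≥0∞) • lebesgue.map (consBit true)) A := by
          rw [Measure.add_apply, Measure.smul_apply, Measure.smul_apply]
          cases b
          · exact le_self_add
          · exact le_add_self
      _ = lebesgue A := by rw [lebesgue_eq_map_consBit]
  calc lebesgue (consBit b ⁻¹' A) = 2 * (2⁻¹ * lebesgue (consBit b ⁻¹' A)) := by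
        rw [← mul_assoc, ENNReal.mul_inv_cancel (by simp) (by simp), one_mul]
    _ ≤ 2 * lebesgue A := by gcongr

theorem length_initSeg {α : Type} (p : ℕ → α) (n : ℕ) : (initSeg p n).length = n := by
  simp [initSeg]

theorem mem_cylinder_iff {w : List Bool} {p : Cantor} :
    p ∈ cylinder w ↔ ∀ i (h : i < w.length), p i = w[i] := by
  refine ⟨fun h i hi => ?_, fun h => List.ext_getElem (length_initSeg _ _) fun i h₁ h₂ => ?_⟩
  · have h : initSeg p w.length = w := h
    have : (initSeg p w.length)[i]'(by rwa [length_initSeg]) = w[i] := by simp only [h]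
    simpa [initSeg] using this
  · simpa [initSeg] using h i h₂

theorem lebesgue_cylinder (w : List Bool) : lebesgue (cylinder w) = 2⁻¹ ^ w.length := by
  have : cylinder w = (Finset.range w.length : Set ℕ).pi fun i => {w.getD i false} := by
    ext p
    simp only [mem_cylinder_iff, Set.mem_pi, Finset.coe_range, Set.mem_Iio, Set.mem_singleton_iff]
    refine forall₂_congr fun i hi => ?_
    rw [List.getD_eq_getElem _ _ hi]
  rw [this, lebesgue, Measure.infinitePi_pi _ fun i _ => measurableSet_singleton _]
  simp

theorem consBit_mem_cylinder {b c : Bool} {w : List Bool} {a : Cantor} :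
    consBit b a ∈ cylinder (c :: w) ↔ b = c ∧ a ∈ cylinder w := by
  simp only [mem_cylinder_iff]
  refine ⟨fun h => ⟨h 0 (by simp), fun i hi => h (i + 1) (by simpa using hi)⟩, ?_⟩
  rintro ⟨rfl, h⟩ (_ | i) hi
  · rfl
  · exact h i (by simpa using hi)

theorem mem_cylinder_nil (a : Cantor) : a ∈ cylinder [] := by simp [mem_cylinder_iff]

/-- Pulling back along `consBit b` at most doubles the measure; the index shift pays for this
factor. -/
theorem isMLTest_consBit {U : ℕ → Set Cantor} (hU : IsMLTest U) (b : Bool) :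
    IsMLTest fun i => consBit b ⁻¹' U (i + 1) := by
  obtain ⟨⟨f, hf, hfU⟩, hm⟩ := hU
  -- The default `b` lets the empty word through: its cylinder is everything, and so is the
  -- preimage.
  refine ⟨⟨fun i k => (f (i + 1) k).bind fun w => if w.getD 0 b = b then some w.tail else none,
    ?_, fun i => ?_⟩, fun i => ?_⟩
  · refine Computable.option_bind (hf.comp (Computable.succ.comp Computable.fst) Computable.snd) ?_
    refine Primrec.to_comp ?_
    refine Primrec.ite ?_ (Primrec.option_some.comp (Primrec.list_tail.comp Primrec.snd))
      (Primrec.const _)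
    exact Primrec.eq.comp ((Primrec.list_getD b).comp Primrec.snd (Primrec.const 0))
      (Primrec.const b)
  · ext a
    simp only [hfU, Set.mem_preimage, Set.mem_iUnion, exists_prop, Option.mem_def,
      Option.bind_eq_some_iff]
    refine exists_congr fun k => ⟨?_, ?_⟩
    · rintro ⟨w, hw, ha⟩
      cases w with
      | nil => exact ⟨[], ⟨[], hw, by simp⟩, mem_cylinder_nil a⟩
      | cons c w =>
        rw [consBit_mem_cylinder] at ha
        exact ⟨w, ⟨c :: w, hw, by simp [ha.1]⟩, ha.2⟩
    · rintro ⟨u, ⟨w, hw, h⟩, ha⟩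
      refine ⟨w, hw, ?_⟩
      split_ifs at h with hb
      cases w with
      | nil => exact mem_cylinder_nil _
      | cons c w =>
        rw [consBit_mem_cylinder]
        simp only [List.getD_cons_zero, List.tail_cons, Option.some.injEq] at h hb
        exact ⟨hb.symm, h ▸ ha⟩
  · calc lebesgue (consBit b ⁻¹' U (i + 1)) ≤ 2 * lebesgue (U (i + 1)) :=
          lebesgue_preimage_consBit_le b _
      _ ≤ 2 * 2⁻¹ ^ (i + 1) := by gcongr; exact hm _
      _ = 2⁻¹ ^ i := by
        rw [pow_succ', ← mul_assoc, ENNReal.mul_inv_cancel (by simp) (by simp), one_mul]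

theorem consBit_mem_MLR {U : ℕ → Set Cantor} (hU : IsUniversalMLTest U) (b : Bool) {a : Cantor}
    (ha : a ∈ MLR U) : consBit b a ∈ MLR U := by
  intro h
  refine ha (hU.2 _ (isMLTest_consBit hU.1 b) ?_)
  simp only [Set.mem_iInter] at h ⊢
  exact fun i => h (i + 1)

/-- Prepend a finite word to a sequence. -/
def appendSeq (v : List Bool) (a : Cantor) : Cantor := v.foldr consBit a

theorem appendSeq_mem_MLR {U : ℕ → Set Cantor} (hU : IsUniversalMLTest U) (v : List Bool)
    {a : Cantor} (ha : a ∈ MLR U) : appendSeq v a ∈ MLR U := by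
  induction v with
  | nil => exact ha
  | cons b v ih => exact consBit_mem_MLR hU b ih

theorem initSeg_consBit (b : Bool) (a : Cantor) (n : ℕ) :
    initSeg (consBit b a) (n + 1) = b :: initSeg a n := by
  simp only [initSeg, List.range_succ_eq_map, List.map_cons, List.map_map]
  rfl

theorem initSeg_appendSeq (v : List Bool) (a : Cantor) (n : ℕ) :
    initSeg (appendSeq v a) (v.length + n) = v ++ initSeg a n := by
  induction v with
  | nil => simp [appendSeq]
  | cons b v ih =>
    rw [List.length_cons, add_right_comm, List.cons_append, ← ih]
    exact initSeg_consBit _ _ _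

theorem MLR_congr {U V : ℕ → Set Cantor} (hU : IsUniversalMLTest U) (hV : IsUniversalMLTest V) :
    MLR U = MLR V := by
  rw [MLR, MLR, (hU.2 V hV.1).antisymm (hV.2 U hU.1)]

/-- The cylinders of `v0ⁿ` form a test that captures `v000…`, so universality puts this point into
every `U i`, hence into a listed cylinder. -/
theorem exists_prefix_of_isUniversalMLTest {U : ℕ → Set Cantor} (hU : IsUniversalMLTest U)
    {f : ℕ → ℕ → Option (List Bool)} (hf : ∀ i, U i = ⋃ (k : ℕ) (w ∈ f i k), cylinder w)
    (v : List Bool) (i : ℕ) :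
    ∃ k j u, f i k = some u ∧ u <+: v ++ List.replicate j false := by
  have htest : IsMLTest fun n => cylinder (v ++ List.replicate n false) := by
    refine ⟨⟨fun n _ => some (v ++ List.replicate n false), ?_, fun n => ?_⟩, fun n => ?_⟩
    · refine (Primrec.option_some.comp (Primrec.list_append.comp (Primrec.const v) ?_)).to_comp
      refine ((Primrec.list_map (Primrec.list_range.comp Primrec.fst)
        (Primrec.const false).to₂)).of_eq fun n => ?_
      simp
    · ext; simp
    · rw [lebesgue_cylinder]
      exact pow_le_pow_of_le_one zero_le (by simp) (by simp)
  have hz : appendSeq v (fun _ => false) ∈ U i := by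
    refine Set.mem_iInter.1 (hU.2 _ htest (Set.mem_iInter.2 fun n => ?_)) i
    have h := initSeg_appendSeq v (fun _ => false) n
    simp only [cylinder, Set.mem_ofPred_eq, List.length_append, List.length_replicate, h]
    simp [initSeg]
  rw [hf] at hz
  simp only [Set.mem_iUnion, exists_prop, Option.mem_def] at hz
  obtain ⟨k, u, hu, hz⟩ := hz
  refine ⟨k, u.length, u, hu, ?_⟩
  have h := initSeg_appendSeq v (fun _ => false) u.length
  have h' : v ++ List.replicate u.length false = initSeg (appendSeq v fun _ => false)
      (u.length + v.length) := by rw [add_comm, h]; simp [initSeg]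
  have hz : initSeg (appendSeq v fun _ => false) u.length = u := hz
  rw [h']
  conv_lhs => rw [← hz]
  exact ⟨_, by rw [initSeg, initSeg, List.range_add, List.map_append]⟩

/-! ### Words converging to sequences -/

section Words

variable {α β : Type}

theorem initSeg_succ (p : ℕ → α) (n : ℕ) : initSeg p (n + 1) = initSeg p n ++ [p n] := by
  simp [initSeg, List.range_succ]

theorem take_initSeg (p : ℕ → α) (m n : ℕ) : (initSeg p n).take m = initSeg p (min m n) := by
  rw [initSeg, ← List.map_take, List.take_range, initSeg]

theorem initSeg_prefix (p : ℕ → α) {m n : ℕ} (h : m ≤ n) : initSeg p m <+: initSeg p n := by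
  rw [List.prefix_iff_eq_take, length_initSeg, take_initSeg, min_eq_left h]

theorem eq_initSeg_of_prefix {w : List α} {p : ℕ → α} {n : ℕ} (h : w <+: initSeg p n) :
    w = initSeg p w.length := by
  have hl := h.length_le
  rw [length_initSeg] at hl
  rw [List.prefix_iff_eq_take, take_initSeg, min_eq_left hl] at h
  exact h

theorem getD_initSeg (p : ℕ → α) {m n : ℕ} (h : m < n) (d : α) : (initSeg p n).getD m d = p m := by
  rw [List.getD_eq_getElem _ _ (by rwa [length_initSeg])]
  simp [initSeg]

theorem initSeg_map (φ : α → β) (p : ℕ → α) (n : ℕ) :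
    (initSeg p n).map φ = initSeg (fun i => φ (p i)) n := by
  rw [initSeg, List.map_map]; rfl

theorem initSeg_getD (w : List α) (d : α) : initSeg (fun i => w.getD i d) w.length = w := by
  refine List.ext_getElem (length_initSeg _ _) fun i _ h => ?_
  simp [initSeg, h]

/-- Every word is an initial segment of a zero-padded sequence, so monotonicity only has to be
checked one step at a time along sequences. -/
theorem prefix_mono_of_initSeg {h : List ℕ → List β}
    (H : ∀ p s, h (initSeg p s) <+: h (initSeg p (s + 1))) (v w : List ℕ) (hvw : v <+: w) :
    h v <+: h w := by
  have hs : ∀ p s t, s ≤ t → h (initSeg p s) <+: h (initSeg p t) := by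
    intro p s t hst
    induction hst with
    | refl => exact List.prefix_rfl
    | step _ ih => exact ih.trans (H p _)
  have hw := initSeg_getD w 0
  have hv : v = initSeg (fun i => w.getD i 0) v.length :=
    eq_initSeg_of_prefix (n := w.length) (by rwa [hw])
  rw [hv]
  conv_rhs => rw [← hw]
  exact hs _ _ _ hvw.length_le

/-- The words `v s` are eventually prefixes of the sequence `a`, of unbounded length. -/
def WordLim (v : ℕ → List α) (a : ℕ → α) : Prop :=
  (∀ᶠ s in atTop, initSeg a (v s).length = v s) ∧ Tendsto (fun s => (v s).length) atTop atTop

theorem wordLim_initSeg (p : ℕ → α) : WordLim (fun s => initSeg p s) p := by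
  refine ⟨Eventually.of_forall fun s => by rw [length_initSeg], ?_⟩
  simpa only [length_initSeg] using! tendsto_id

theorem WordLim.congr {v w : ℕ → List α} {a : ℕ → α} (h : WordLim v a)
    (hvw : ∀ᶠ s in atTop, v s = w s) : WordLim w a := by
  refine ⟨?_, h.2.congr' ?_⟩
  · filter_upwards [h.1, hvw] with s h₁ h₂
    rwa [← h₂]
  · filter_upwards [hvw] with s hs
    rw [hs]

theorem WordLim.comp {v : ℕ → List α} {a : ℕ → α} (h : WordLim v a) {φ : ℕ → ℕ}
    (hφ : Tendsto φ atTop atTop) : WordLim (fun s => v (φ s)) a :=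
  ⟨hφ.eventually h.1, h.2.comp hφ⟩

theorem WordLim.map {v : ℕ → List α} {a : ℕ → α} (h : WordLim v a) (φ : α → β) :
    WordLim (fun s => (v s).map φ) (fun i => φ (a i)) := by
  refine ⟨?_, by simpa only [List.length_map] using h.2⟩
  filter_upwards [h.1] with s hs
  rw [List.length_map, ← initSeg_map, hs]

theorem WordLim.exists_initSeg_prefix {v : ℕ → List α} {a : ℕ → α} (h : WordLim v a) (k : ℕ) :
    ∃ s, initSeg a k <+: v s := by
  obtain ⟨s, h₁, h₂⟩ := (h.1.and (h.2.eventually_ge_atTop k)).exists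
  exact ⟨s, h₁ ▸ initSeg_prefix a h₂⟩

theorem WordLim.eq_initSeg {v : ℕ → List α} {a : ℕ → α} (h : WordLim v a)
    (hv : ∀ s, v s <+: v (s + 1)) (s : ℕ) : v s = initSeg a (v s).length := by
  have hs : ∀ t, s ≤ t → v s <+: v t := by
    intro t hst
    induction hst with
    | refl => exact List.prefix_rfl
    | step _ ih => exact ih.trans (hv _)
  obtain ⟨t, h₁, h₂⟩ := (h.1.and (eventually_ge_atTop s)).exists
  exact eq_initSeg_of_prefix (n := (v t).length) (by rw [h₁]; exact hs t h₂)

theorem WordLim.unique {v : ℕ → List α} {a b : ℕ → α} (ha : WordLim v a) (hb : WordLim v b) :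
    a = b := by
  funext i
  obtain ⟨s, h₁, h₂, h₃⟩ := (ha.1.and (hb.1.and (ha.2.eventually_ge_atTop (i + 1)))).exists
  have h := h₁.trans h₂.symm
  rw [← getD_initSeg a h₃ (a i), h, getD_initSeg b h₃]

/-- The input words `v s` may be wrong at finitely many stages and need not increase. This is what
allows a machine to be run on inputs that depend on a guess. -/
theorem wordLim_of_mono {h : List ℕ → List ℕ} (hm : ∀ v w, v <+: w → h v <+: h w) {p q : Baire}
    (hq : ∀ k, ∃ m, initSeg q k <+: h (initSeg p m)) {v : ℕ → List ℕ} (hv : WordLim v p) :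
    WordLim (fun s => h (v s)) q := by
  have key : ∀ m, initSeg q (h (initSeg p m)).length = h (initSeg p m) := by
    intro m
    obtain ⟨n, hn⟩ := hq (h (initSeg p m)).length
    have h₁ := hn.trans (hm _ _ (initSeg_prefix p (le_max_right m n)))
    have h₂ := hm _ _ (initSeg_prefix p (le_max_left m n))
    exact (List.prefix_of_prefix_length_le h₁ h₂ (length_initSeg q _).le).eq_of_length
      (length_initSeg q _)
  refine ⟨?_, tendsto_atTop.2 fun k => ?_⟩
  · filter_upwards [hv.1] with s hs
    rw [← hs, key]
  · obtain ⟨m, hm'⟩ := hq k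
    filter_upwards [hv.1, hv.2.eventually_ge_atTop m] with s hs hl
    have := (hm'.trans (hm _ _ (initSeg_prefix p hl))).length_le
    rwa [length_initSeg, hs] at this

/-- The word `x₀, n, x₁, n, …`. -/
def interleaveConst (w : List ℕ) (n : ℕ) : List ℕ := w.flatMap fun x => [x, n]

theorem interleaveConst_prefix {v w : List ℕ} (h : v <+: w) (n : ℕ) :
    interleaveConst v n <+: interleaveConst w n := by
  obtain ⟨u, rfl⟩ := h
  exact ⟨interleaveConst u n, by simp [interleaveConst]⟩

theorem interleaveConst_initSeg (p : Baire) (n k : ℕ) :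
    interleaveConst (initSeg p k) n = initSeg (pair p fun _ => n) (2 * k) := by
  induction k with
  | zero => rfl
  | succ k ih =>
    rw [mul_add, mul_one, initSeg_succ, initSeg_succ, initSeg_succ, ← ih]
    have h₁ : pair p (fun _ => n) (2 * k) = p k := congrFun (fst_pair p fun _ => n) k
    have h₂ : pair p (fun _ => n) (2 * k + 1) = n := congrFun (snd_pair p fun _ => n) k
    rw [h₁, h₂]
    simp [interleaveConst]

theorem WordLim.interleaveConst {v : ℕ → List ℕ} {p : Baire} (h : WordLim v p) (n : ℕ) :
    WordLim (fun s => interleaveConst (v s) n) (pair p fun _ => n) := by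
  have h' : WordLim (fun s => initSeg (pair p fun _ => n) (2 * (v s).length))
      (pair p fun _ => n) :=
    (wordLim_initSeg (pair p fun _ => n)).comp (φ := fun s => 2 * (v s).length)
      (tendsto_atTop_mono (fun s => by omega) h.2)
  refine h'.congr ?_
  filter_upwards [h.1] with s hs
  rw [← interleaveConst_initSeg, hs]

theorem primrec_interleaveConst : Primrec₂ interleaveConst :=
  Primrec.list_flatMap Primrec.fst (Primrec.list_cons.comp Primrec.snd
    (Primrec.list_cons.comp (Primrec.snd.comp Primrec.fst) (Primrec.const []))).to₂

end Words

/-! ### Machines, extension into a universal test, and limit guesses of layers -/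

section Computability

/-- The partial function on Baire space computed by a monotone word function. -/
noncomputable def wordFun (h : List ℕ → List ℕ) : Baire →. Baire := fun p =>
  ⟨∃ q, WordLim (fun s => h (initSeg p s)) q, Classical.choose⟩

theorem mem_wordFun {h : List ℕ → List ℕ} {p q : Baire} :
    q ∈ wordFun h p ↔ WordLim (fun s => h (initSeg p s)) q := by
  refine ⟨?_, fun hq => ⟨⟨q, hq⟩, WordLim.unique
    (Classical.choose_spec (⟨q, hq⟩ : ∃ q, WordLim (fun s => h (initSeg p s)) q)) hq⟩⟩
  rintro ⟨hd, rfl⟩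
  exact Classical.choose_spec hd

theorem isComputable_wordFun {h : List ℕ → List ℕ} (hc : Computable h)
    (hm : ∀ v w, v <+: w → h v <+: h w) : IsComputable (wordFun h) :=
  ⟨h, hc, hm, fun _ _ hq k => (mem_wordFun.1 hq).exists_initSeg_prefix k⟩

theorem IsComputable.bind {F G : Baire →. Baire} (hF : IsComputable F) (hG : IsComputable G) :
    IsComputable fun p => (F p).bind G := by
  obtain ⟨f, hf, mf, lf⟩ := hF
  obtain ⟨g, hg, mg, lg⟩ := hG
  refine ⟨fun w => g (f w), hg.comp hf, fun v w h => mg _ _ (mf _ _ h), fun p q hq k => ?_⟩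
  obtain ⟨a, ha, hq⟩ := Part.mem_bind_iff.1 hq
  obtain ⟨m, hm⟩ := lg a q hq k
  obtain ⟨n, hn⟩ := lf p a ha m
  exact ⟨n, hm.trans (mg _ _ hn)⟩

/-- The bound ensures that the first `|w| / 4` output entries depend only on entries of `w`. -/
theorem isComputable_reindex {φ : ℕ → ℕ} (hφ : Primrec φ) (hb : ∀ n, φ n ≤ 4 * n + 3) :
    IsComputable fun r => Part.some fun n => r (φ n) := by
  let h : List ℕ → List ℕ := fun w => (List.range (w.length / 4)).map fun j => w.getD (φ j) 0
  have hs : ∀ p s, h (initSeg p s) = initSeg (fun n => p (φ n)) (s / 4) := by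
    intro p s
    simp only [h, length_initSeg]
    refine List.map_congr_left fun j hj => getD_initSeg p ?_ 0
    have := hb j
    rw [List.mem_range] at hj
    omega
  refine ⟨h, ?_, prefix_mono_of_initSeg fun p s => ?_, fun p q hq k => ⟨4 * k, ?_⟩⟩
  · refine (Primrec.list_map (Primrec.list_range.comp
      (Primrec.nat_div.comp Primrec.list_length (Primrec.const 4))) ?_).to_comp
    exact (Primrec.list_getD 0).comp Primrec.fst (hφ.comp Primrec.snd)
  · rw [hs, hs]
    exact initSeg_prefix _ (by omega)
  · rw [Part.mem_some_iff.1 hq, hs]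
    exact initSeg_prefix _ (by omega)

theorem exists_computable_search {α : Type} [Primcodable α] {P : α → ℕ → Bool}
    (hP : Computable₂ P) (h : ∀ a, ∃ n, P a n = true) :
    ∃ g : α → ℕ, Computable g ∧ ∀ a, P a (g a) = true := by
  have hmem : ∀ a, ∃ n, n ∈ Nat.rfind fun n => (P a n : Part Bool) := fun a =>
    let ⟨_, hn⟩ := h a
    let ⟨m, hm, _⟩ := Nat.rfind_min' hn
    ⟨m, hm⟩
  choose g hg using hmem
  refine ⟨g, (Partrec.rfind (p := fun a n => (P a n : Part Bool)) hP.partrec₂).of_eq_tot hg,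
    fun a => ?_⟩
  simpa using Nat.rfind_spec (hg a)

theorem primrec_isPrefix : Primrec₂ fun u w : List Bool => decide (w.take u.length = u) :=
  Primrec.beq.comp (Primrec.list_take.comp (Primrec.list_length.comp Primrec.fst) Primrec.snd)
    Primrec.fst

theorem cylinder_subset_of_prefix {u w : List Bool} (h : u <+: w) : cylinder w ⊆ cylinder u := by
  intro a ha
  rw [mem_cylinder_iff] at ha ⊢
  intro i hi
  rw [ha i (hi.trans_le h.length_le), h.getElem hi]

/-- Appending enough zeros to a word takes its cylinder into a given `U i`, and the number of zeros
can be searched for. Doing so for `0, …, s` in turn preserves earlier inclusions, since cylinders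
only shrink. -/
theorem exists_computable_extend {U : ℕ → Set Cantor} (hU : IsUniversalMLTest U) :
    ∃ e : ℕ → List Bool → List Bool, Computable₂ e ∧
      (∀ s v, v <+: e s v) ∧ ∀ s v, ∀ i ≤ s, cylinder (e s v) ⊆ U i := by
  obtain ⟨f, hf, hfU⟩ := hU.1.1
  -- The search variable codes a pair: the index of a listed cylinder and a number of zeros.
  let P : ℕ × List Bool → ℕ → Bool := fun a n => ((f a.1 n.unpair.1).map fun u =>
    decide ((a.2 ++ List.replicate n.unpair.2 false).take u.length = u)).getD false
  have hrep : Primrec fun n => List.replicate n false :=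
    (Primrec.list_map Primrec.list_range (Primrec.const false).to₂).of_eq fun n => by simp
  have hP : Computable₂ P := by
    refine Computable.option_getD (Computable.option_map
      (hf.comp (Computable.fst.comp Computable.fst)
        (Computable.fst.comp (Computable.unpair.comp Computable.snd))) ?_) (Computable.const false)
    refine (primrec_isPrefix.comp Primrec.snd (Primrec.list_append.comp ?_ ?_)).to_comp
    · exact Primrec.snd.comp (Primrec.fst.comp Primrec.fst)
    · exact hrep.comp (Primrec.snd.comp (Primrec.unpair.comp (Primrec.snd.comp Primrec.fst)))
  obtain ⟨g, hg, hgP⟩ := exists_computable_search hP fun a => by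
    obtain ⟨k, j, u, hu, hp⟩ := exists_prefix_of_isUniversalMLTest hU hfU a.2 a.1
    refine ⟨Nat.pair k j, ?_⟩
    simp only [P, Nat.unpair_pair, hu, Option.map_some, Option.getD_some, decide_eq_true_eq]
    exact (List.prefix_iff_eq_take.1 hp).symm
  let e₁ : ℕ → List Bool → List Bool := fun i v =>
    v ++ List.replicate (g (i, v)).unpair.2 false
  have he₁ : Computable₂ e₁ := Computable.list_append.comp Computable.snd
    (hrep.to_comp.comp (Computable.snd.comp (Computable.unpair.comp hg)))
  have hsub : ∀ i v, cylinder (e₁ i v) ⊆ U i := by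
    intro i v a ha
    have h := hgP (i, v)
    simp only [P] at h
    cases hu : f i (g (i, v)).unpair.1 with
    | none => simp [hu] at h
    | some u =>
      simp only [hu, Option.map_some, Option.getD_some, decide_eq_true_eq] at h
      rw [hfU]
      simp only [Set.mem_iUnion, exists_prop, Option.mem_def]
      exact ⟨_, u, hu, cylinder_subset_of_prefix (List.prefix_iff_eq_take.2 h.symm) ha⟩
  let e : ℕ → List Bool → List Bool := fun s v =>
    Nat.rec (e₁ 0 v) (fun i o => e₁ (i + 1) o) s
  refine ⟨e, ?_, fun s v => ?_, fun s v => ?_⟩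
  · refine Computable.nat_rec (f := fun a : ℕ × List Bool => a.1) (g := fun a => e₁ 0 a.2)
      (h := fun _ b => e₁ (b.1 + 1) b.2) Computable.fst
      (he₁.comp (Computable.const 0) Computable.snd) ?_
    exact he₁.comp (Computable.succ.comp (Computable.fst.comp Computable.snd))
      (Computable.snd.comp Computable.snd)
  · induction s with
    | zero => exact List.prefix_append _ _
    | succ s ih => exact ih.trans (List.prefix_append _ _)
  · induction s with
    | zero =>
      intro i hi
      obtain rfl := Nat.le_zero.1 hi
      exact hsub _ _
    | succ s ih =>
      intro i hi
      obtain hi | rfl := Nat.le_succ_iff.1 hi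
      · exact (cylinder_subset_of_prefix (List.prefix_append _ _)).trans (ih i hi)
      · exact hsub _ _

/-- Whether the first `s` cylinders of the `n`-th open set contain the cylinder of `w`. -/
def covered (f : ℕ → ℕ → Option (List Bool)) (n s : ℕ) (w : List Bool) : Bool :=
  Nat.rec false (fun k b => b || ((f n k).map fun u => decide (w.take u.length = u)).getD false) s

theorem covered_eq_true {f : ℕ → ℕ → Option (List Bool)} {n s : ℕ} {w : List Bool} :
    covered f n s w = true ↔ ∃ k < s, ∃ u, f n k = some u ∧ w.take u.length = u := by
  induction s with
  | zero => simp [covered]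
  | succ s ih =>
    have : covered f n (s + 1) w = (covered f n s w ||
      ((f n s).map fun u => decide (w.take u.length = u)).getD false) := rfl
    rw [this, Bool.or_eq_true, ih]
    simp only [Nat.lt_succ_iff_lt_or_eq, or_and_right, exists_or, exists_eq_left]
    refine or_congr Iff.rfl ?_
    cases f n s <;> simp

/-- The least `n` such that the `n`-th open set is not seen to contain the cylinder of `w` within
`s` steps. -/
def layerGuess (f : ℕ → ℕ → Option (List Bool)) (s : ℕ) (w : List Bool) : ℕ :=
  Nat.rec 0 (fun _ n => bif covered f n s w then n + 1 else n) s

theorem computable_covered {f : ℕ → ℕ → Option (List Bool)} (hf : Computable₂ f) :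
    Computable fun a : ℕ × ℕ × List Bool => covered f a.1 a.2.1 a.2.2 := by
  have hmap : Computable fun c : (ℕ × ℕ × List Bool) × ℕ × Bool =>
      (f c.1.1 c.2.1).map fun u => decide (c.1.2.2.take u.length = u) := by
    refine Computable.option_map (f := fun c : (ℕ × ℕ × List Bool) × ℕ × Bool => f c.1.1 c.2.1)
      (g := fun c u => decide (c.1.2.2.take u.length = u))
      (hf.comp (Computable.fst.comp Computable.fst) (Computable.fst.comp Computable.snd)) ?_
    exact (primrec_isPrefix.comp Primrec.snd
      (Primrec.snd.comp (Primrec.snd.comp (Primrec.fst.comp Primrec.fst)))).to_comp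
  have hstep : Computable₂ fun (a : ℕ × ℕ × List Bool) (b : ℕ × Bool) =>
      b.2 || ((f a.1 b.1).map fun u => decide (a.2.2.take u.length = u)).getD false :=
    Primrec.or.to_comp.comp (Computable.snd.comp Computable.snd)
      (hmap.option_getD (Computable.const false))
  have h := Computable.nat_rec (f := fun a : ℕ × ℕ × List Bool => a.2.1)
    (Computable.fst.comp Computable.snd) (Computable.const false) hstep
  exact h.of_eq fun a => rfl

theorem computable_layerGuess {f : ℕ → ℕ → Option (List Bool)} (hf : Computable₂ f) :
    Computable fun a : ℕ × List Bool => layerGuess f a.1 a.2 := by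
  have hcov : Computable fun c : (ℕ × List Bool) × ℕ × ℕ => covered f c.2.2 c.1.1 c.1.2 :=
    (computable_covered hf).comp (g := fun c : (ℕ × List Bool) × ℕ × ℕ => (c.2.2, c.1))
      ((Computable.snd.comp Computable.snd).pair Computable.fst)
  have hstep : Computable₂ fun (a : ℕ × List Bool) (b : ℕ × ℕ) =>
      bif covered f b.2 a.1 a.2 then b.2 + 1 else b.2 :=
    Computable.cond hcov
      (Computable.succ.comp (Computable.snd.comp Computable.snd))
      (Computable.snd.comp Computable.snd)
  have h := Computable.nat_rec (f := fun a : ℕ × List Bool => a.1)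
    Computable.fst (Computable.const 0) hstep
  exact h.of_eq fun a => rfl

theorem layerGuess_eq {f : ℕ → ℕ → Option (List Bool)} {n s : ℕ} {w : List Bool} (hns : n ≤ s)
    (hlt : ∀ i < n, covered f i s w = true) (hn : covered f n s w = false) :
    layerGuess f s w = n := by
  have : ∀ t, (Nat.rec 0 (fun _ n => bif covered f n s w then n + 1 else n) t : ℕ) = min t n := by
    intro t
    induction t with
    | zero => simp
    | succ t ih =>
      simp only [ih]
      rcases lt_or_ge t n with h | h
      · rw [min_eq_left h.le, hlt t h, min_eq_left h]; rfl
      · rw [min_eq_right h, hn, min_eq_right (h.trans t.le_succ)]; rfl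
  rw [layerGuess, this, min_eq_right hns]

/-- The limit is the least `n` with `z ∉ U n`. Each smaller index is refuted at a finite stage; `n`
itself is never refuted by a prefix of `z`. Since tests need not be nested, all smaller indices have
to be waited for. -/
theorem exists_eventually_layerGuess_eq {U : ℕ → Set Cantor}
    {f : ℕ → ℕ → Option (List Bool)} (hf : ∀ i, U i = ⋃ (k : ℕ) (w ∈ f i k), cylinder w)
    {v : ℕ → List Bool} {z : Cantor} (hv : WordLim v z) (hz : z ∈ MLR U) :
    ∃ n, z ∉ U n ∧ ∀ᶠ s in atTop, layerGuess f s (v s) = n := by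
  classical
  have hz : ∃ n, z ∉ U n := by simpa [MLR] using hz
  have hcov : ∀ i < Nat.find hz, ∀ᶠ s in atTop, covered f i s (v s) = true := by
    intro i hi
    have h := not_not.1 (Nat.find_min hz hi)
    rw [hf] at h
    simp only [Set.mem_iUnion, exists_prop, Option.mem_def] at h
    obtain ⟨k, u, hu, hzu⟩ := h
    have hzu : initSeg z u.length = u := hzu
    filter_upwards [hv.1, hv.2.eventually_ge_atTop u.length, eventually_gt_atTop k]
      with s h₁ h₂ h₃
    refine covered_eq_true.2 ⟨k, h₃, u, hu, ?_⟩
    rw [← h₁, take_initSeg, min_eq_left h₂, hzu]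
  have hall : ∀ᶠ s in atTop, ∀ i < Nat.find hz, covered f i s (v s) = true :=
    (Set.finite_Iio (Nat.find hz)).eventually_all.2 hcov
  refine ⟨Nat.find hz, Nat.find_spec hz, ?_⟩
  filter_upwards [hall, hv.1, eventually_ge_atTop (Nat.find hz)] with s h₁ h₂ h₃
  refine layerGuess_eq h₃ h₁ ?_
  rw [← Bool.not_eq_true, covered_eq_true]
  rintro ⟨k, -, u, hu, hw⟩
  refine Nat.find_spec hz ?_
  have hle : u.length ≤ (v s).length := by
    rw [← hw]; exact (List.length_take_le' _ _)
  have hzu : z ∈ cylinder u := by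
    rw [← h₂, take_initSeg, min_eq_left hle] at hw
    exact hw
  rw [hf]
  simp only [Set.mem_iUnion, exists_prop, Option.mem_def]
  exact ⟨k, u, hu, hzu⟩

end Computability

/-! ### One layer bounds the mind changes -/

section MindChanges

variable (g : List ℕ → ℕ) (h₀ : List ℕ → List Bool) (e : ℕ → List Bool → List Bool)

/-- The word to be put before `h₀ w`: each time that the guess `g` changes on a prefix of `w`, the
word written so far is extended by `e`. -/
def stem (w : List ℕ) : List Bool :=
  Nat.rec [] (fun i v => bif g (w.take i) == g (w.take (i + 1)) then v
    else e (i + 1) (v ++ h₀ (w.take i))) w.length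

variable {g h₀ e}

theorem stem_initSeg_succ (p : Baire) (s : ℕ) :
    stem g h₀ e (initSeg p (s + 1)) =
      if g (initSeg p s) = g (initSeg p (s + 1)) then stem g h₀ e (initSeg p s)
      else e (s + 1) (stem g h₀ e (initSeg p s) ++ h₀ (initSeg p s)) := by
  let S : ℕ → List Bool := fun s => Nat.rec [] (fun i v =>
    bif g (initSeg p i) == g (initSeg p (i + 1)) then v
    else e (i + 1) (v ++ h₀ (initSeg p i))) s
  -- The first `s` steps of the recursion only see prefixes of length at most `s`, so they do not
  -- depend on `n`.
  have aux : ∀ n, ∀ s ≤ n, (Nat.rec [] (fun i v =>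
      bif g ((initSeg p n).take i) == g ((initSeg p n).take (i + 1)) then v
      else e (i + 1) (v ++ h₀ ((initSeg p n).take i))) s : List Bool) = S s := by
    intro n s hs
    induction s with
    | zero => rfl
    | succ s ih =>
      simp only [ih (by omega), S]
      rw [take_initSeg, take_initSeg, min_eq_left hs, min_eq_left (by omega)]
  have hS : ∀ n, stem g h₀ e (initSeg p n) = S n := fun n => by
    rw [stem, length_initSeg, aux n n le_rfl]
  rw [hS, hS]
  change (bif g (initSeg p s) == g (initSeg p (s + 1)) then S s
    else e (s + 1) (S s ++ h₀ (initSeg p s))) = _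
  by_cases hg : g (initSeg p s) = g (initSeg p (s + 1))
  · simp [hg]
  · rw [if_neg hg, beq_false_of_ne hg, cond_false]

/-- A change of guess discards nothing: the whole output so far becomes part of the new stem. -/
theorem stem_append_prefix (he : ∀ s v, v <+: e s v)
    (mh : ∀ v w, v <+: w → h₀ v <+: h₀ w) (p : Baire) (s : ℕ) :
    stem g h₀ e (initSeg p s) ++ h₀ (initSeg p s) <+:
      stem g h₀ e (initSeg p (s + 1)) ++ h₀ (initSeg p (s + 1)) := by
  rw [stem_initSeg_succ]
  split_ifs with h
  · exact List.prefix_append_right_inj _ |>.2 (mh _ _ (initSeg_prefix p s.le_succ))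
  · exact (he _ _).trans (List.prefix_append _ _)

theorem computable_stem (hg : Computable g) (hh : Computable h₀) (he : Computable₂ e) :
    Computable (stem g h₀ e) := by
  have ht : Computable fun c : List ℕ × ℕ × List Bool => c.1.take c.2.1 :=
    (Primrec.list_take.comp (Primrec.fst.comp Primrec.snd) Primrec.fst).to_comp
  have ht' : Computable fun c : List ℕ × ℕ × List Bool => c.1.take (c.2.1 + 1) :=
    (Primrec.list_take.comp (Primrec.succ.comp (Primrec.fst.comp Primrec.snd)) Primrec.fst).to_comp
  have heq : Computable fun c : List ℕ × ℕ × List Bool =>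
      g (c.1.take c.2.1) == g (c.1.take (c.2.1 + 1)) :=
    (Primrec.beq (α := ℕ)).to_comp.comp (hg.comp ht) (hg.comp ht')
  have hext : Computable fun c : List ℕ × ℕ × List Bool =>
      e (c.2.1 + 1) (c.2.2 ++ h₀ (c.1.take c.2.1)) :=
    he.comp (Computable.succ.comp (Computable.fst.comp Computable.snd))
      (Computable.list_append.comp (Computable.snd.comp Computable.snd) (hh.comp ht))
  have hstep : Computable₂ fun (w : List ℕ) (c : ℕ × List Bool) =>
      bif g (w.take c.1) == g (w.take (c.1 + 1)) then c.2
      else e (c.1 + 1) (c.2 ++ h₀ (w.take c.1)) :=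
    Computable.cond heq (Computable.snd.comp Computable.snd) hext
  have h := Computable.nat_rec (f := fun w : List ℕ => w.length)
    Computable.list_length (Computable.const []) hstep
  exact h.of_eq fun w => rfl

/-- The word of the entries of `w` at even places. -/
def evens (w : List ℕ) : List ℕ := (List.range (w.length / 2)).map fun j => w.getD (2 * j) 0

theorem primrec_evens : Primrec evens :=
  Primrec.list_map (Primrec.list_range.comp
    (Primrec.nat_div.comp Primrec.list_length (Primrec.const 2)))
    ((Primrec.list_getD 0).comp Primrec.fst
      (Primrec.nat_mul.comp (Primrec.const 2) Primrec.snd)).to₂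

theorem evens_initSeg (r : Baire) (n : ℕ) : evens (initSeg r n) = initSeg (fst r) (n / 2) := by
  rw [evens, length_initSeg]
  refine List.map_congr_left fun j hj => getD_initSeg r ?_ 0
  rw [List.mem_range] at hj
  omega

/-- On a prefix of `⟨p, q⟩`, apply `k` to a prefix of `p`, with the value of `g` at the prefix of `p`
of length `q 0` as a parameter. -/
def runGuess (g : List ℕ → ℕ) (k : ℕ → List ℕ → List ℕ) (w : List ℕ) : List ℕ :=
  bif decide (2 ≤ w.length) && decide (w.getD 1 0 ≤ w.length / 2) then
    k (g ((evens w).take (w.getD 1 0))) (evens w) else []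

theorem runGuess_initSeg (k : ℕ → List ℕ → List ℕ) (r : Baire) (s : ℕ) :
    runGuess g k (initSeg r s) = if 2 ≤ s ∧ r 1 ≤ s / 2 then
      k (g (initSeg (fst r) (r 1))) (initSeg (fst r) (s / 2)) else [] := by
  rw [runGuess, length_initSeg, evens_initSeg]
  by_cases hs : 2 ≤ s
  · rw [getD_initSeg r hs]
    by_cases hr : r 1 ≤ s / 2
    · simp [hs, hr, take_initSeg]
    · simp [hr]
  · simp [hs]

theorem computable_runGuess (hg : Computable g) {k : ℕ → List ℕ → List ℕ} (hk : Computable₂ k) :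
    Computable (runGuess g k) := by
  have hn : Primrec fun w : List ℕ => w.getD 1 0 :=
    (Primrec.list_getD 0).comp Primrec.id (Primrec.const 1)
  refine Computable.cond (Primrec.and.comp ?_ ?_).to_comp (hk.comp (hg.comp ?_)
    primrec_evens.to_comp) (Computable.const [])
  · exact (Primrec.nat_le.comp (Primrec.const 2) Primrec.list_length).decide
  · exact (Primrec.nat_le.comp hn
      (Primrec.nat_div.comp Primrec.list_length (Primrec.const 2))).decide
  · exact (Primrec.list_take.comp hn primrec_evens).to_comp

/-- Nothing is output before `q 0` and the first `q 0` entries of `p` are known; from then on the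
parameter passed to `k` is fixed. -/
theorem runGuess_mono {k : ℕ → List ℕ → List ℕ}
    (mk : ∀ N v w, v <+: w → k N v <+: k N w) (v w : List ℕ) (h : v <+: w) :
    runGuess g k v <+: runGuess g k w := by
  refine prefix_mono_of_initSeg (fun r s => ?_) v w h
  rw [runGuess_initSeg, runGuess_initSeg]
  by_cases hs : 2 ≤ s ∧ r 1 ≤ s / 2
  · rw [if_pos hs, if_pos ⟨by omega, by omega⟩]
    exact mk _ _ _ (initSeg_prefix _ (by omega))
  · rw [if_neg hs]
    exact List.nil_prefix

/-- A problem reduces to `LAY W` if it is solved with finitely many mind changes (the guesses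
`g` converge, and `k` computes a solution from the limit), and if moreover a random sequence can be
computed from the instance. -/
theorem le_LAY_of_limit {W : ℕ → Set Cantor} (hW : IsUniversalMLTest W) {X Y : RepSpace}
    (f : Problem X Y) {k : ℕ → List ℕ → List ℕ} (hh₀ : Computable h₀) (hg : Computable g)
    (hk : Computable₂ k) (mh₀ : ∀ v w, v <+: w → h₀ v <+: h₀ w)
    (mk : ∀ N v w, v <+: w → k N v <+: k N w)
    (H : ∀ p x, x ∈ X.δ p → x ∈ f.dom → ∃ z ∈ MLR W, ∃ N q, ∃ y ∈ Y.δ q, y ∈ f x ∧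
      WordLim (fun s => h₀ (initSeg p s)) z ∧ (∀ᶠ s in atTop, g (initSeg p s) = N) ∧
      WordLim (fun s => k N (initSeg p s)) q) :
    Le f (LAY W) := by
  obtain ⟨e, he, hpre, hcyl⟩ := exists_computable_extend hW
  let out : List ℕ → List Bool := fun w => stem g h₀ e w ++ h₀ w
  have hout : ∀ p s, out (initSeg p s) <+: out (initSeg p (s + 1)) :=
    stem_append_prefix hpre mh₀
  let h : List ℕ → List ℕ := fun w => (out w).map Bool.toNat
  have hh : Computable h := by
    have hc : Computable out :=
      Computable.list_append.comp (computable_stem hg hh₀ he) hh₀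
    have hmap : Primrec fun w : List Bool => w.map Bool.toNat :=
      Primrec.list_map Primrec.id ((Primrec.dom_finite Bool.toNat).comp Primrec.snd).to₂
    exact hmap.to_comp.comp hc
  refine ⟨wordFun (runGuess g k), wordFun h,
    isComputable_wordFun (computable_runGuess hg hk) (runGuess_mono mk),
    isComputable_wordFun hh (prefix_mono_of_initSeg fun p s => (hout p s).map _),
    fun G hG p x hx hxf => ?_⟩
  obtain ⟨z, hz, N, q, y, hyq, hy, hlz, hgN, hlq⟩ := H p x hx hxf
  obtain ⟨s₀, hs₀⟩ := eventually_atTop.1 hgN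
  -- Once the guess has converged the stem is frozen, so the query is a finite word followed by `z`.
  have hstem : ∀ s ≥ s₀, stem g h₀ e (initSeg p s) = stem g h₀ e (initSeg p s₀) := by
    intro s hs
    induction s, hs using Nat.le_induction with
    | base => rfl
    | succ s hs ih =>
      rw [stem_initSeg_succ, if_pos ((hs₀ s hs).trans (hs₀ (s + 1) (by omega)).symm), ih]
  set v := stem g h₀ e (initSeg p s₀)
  have hlim : WordLim (fun s => out (initSeg p s)) (appendSeq v z) := by
    have h' : WordLim (fun s => v ++ h₀ (initSeg p s)) (appendSeq v z) := by
      refine ⟨?_, ?_⟩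
      · filter_upwards [hlz.1] with s hs
        rw [List.length_append, initSeg_appendSeq, hs]
      · simp only [List.length_append]
        exact tendsto_atTop_mono (fun s => Nat.le_add_left _ _) hlz.2
    refine h'.congr ?_
    filter_upwards [eventually_ge_atTop s₀] with s hs
    simp only [out, hstem s hs]
  set z' := appendSeq v z
  have hz' : z' ∈ MLR W := appendSeq_mem_MLR hW v hz
  let a : Baire := fun n => (z' n).toNat
  have ha : a ∈ wordFun h p := mem_wordFun.2 (hlim.map Bool.toNat)
  have haz : z' ∈ cantorSpace.δ a :=
    ⟨fun n => Bool.toNat_le _, by funext n; cases hn : z' n <;> simp [a, hn]⟩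
  obtain ⟨b, hb, (n : ℕ), hbn, hn⟩ := hG a z' haz (by rw [dom_LAY]; exact hz')
  have hn : z' ∉ W n := hn
  have hbn : n = b 0 := Part.mem_some_iff.1 hbn
  -- A change at stage `s + 1 > n` would have steered the query into `W n`, contrary to the answer
  -- `n`.
  have hstable : ∀ s ≥ n, g (initSeg p (s + 1)) = g (initSeg p s) := by
    intro s hs
    by_contra hne
    refine hn (hcyl (s + 1) (out (initSeg p s)) n (by omega) ?_)
    have hpre' : e (s + 1) (out (initSeg p s)) <+: out (initSeg p (s + 1)) := by
      simp only [out]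
      rw [stem_initSeg_succ, if_neg (Ne.symm hne)]
      exact List.prefix_append _ _
    refine cylinder_subset_of_prefix hpre' ?_
    exact (hlim.eq_initSeg (hout p) (s + 1)).symm
  have hgn : ∀ s ≥ n, g (initSeg p s) = g (initSeg p n) := by
    intro s hs
    induction s, hs using Nat.le_induction with
    | base => rfl
    | succ s hs ih => rw [hstable s hs, ih]
  have hN : g (initSeg p n) = N := by
    rw [← hgn (max n s₀) (le_max_left _ _), hs₀ _ (le_max_right _ _)]
  have hq : q ∈ wordFun (runGuess g k) (pair p b) := by
    rw [mem_wordFun]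
    -- A prefix of length `s` of the pair contains `s / 2` entries of `p`.
    refine (hlq.comp (φ := fun s => s / 2) ?_).congr ?_
    · exact Nat.tendsto_div_const_atTop (by norm_num)
    · have h₁ : pair p b 1 = n := (congrFun (snd_pair p b) 0).trans hbn.symm
      filter_upwards [eventually_ge_atTop (2 * n + 2)] with s hs
      rw [runGuess_initSeg, fst_pair, h₁, if_pos ⟨by omega, by omega⟩, hN]
  exact ⟨q, Part.mem_bind_iff.2 ⟨a, ha, Part.mem_bind_iff.2 ⟨b, hb, hq⟩⟩, y, hyq, hy⟩

end MindChanges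

/-! ### Compositions of problems below `LAY` -/

section Composition

/-- What a reduction to `LAY V` provides, in terms of word functions. -/
theorem exists_wordFun_of_le_LAY {V : ℕ → Set Cantor} {X Y : RepSpace} {f : Problem X Y}
    (hf : Le f (LAY V)) :
    ∃ k h : List ℕ → List ℕ, Computable k ∧ Computable h ∧
      (∀ v w, v <+: w → k v <+: k w) ∧ (∀ v w, v <+: w → h v <+: h w) ∧
      ∀ p x, x ∈ X.δ p → x ∈ f.dom → ∃ z ∈ MLR V,
        (∀ v, WordLim v p → WordLim (fun s => (h (v s)).map fun i => decide (i = 1)) z) ∧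
        ∀ n, z ∉ V n → ∃ c, ∃ y ∈ Y.δ c, y ∈ f x ∧
          ∀ v, WordLim v (pair p fun _ => n) → WordLim (fun s => k (v s)) c := by
  classical
  obtain ⟨K, H, ⟨k, hk, mk, lk⟩, ⟨h, hh, mh, lh⟩, hG⟩ := hf
  refine ⟨k, h, hk, hh, mk, mh, fun p x hx hxf => ?_⟩
  have hlay : ∀ a : Baire, ∃ n, ∀ z ∈ cantorSpace.δ a, z ∈ MLR V → z ∉ V n := by
    intro a
    by_cases h' : ∃ z ∈ cantorSpace.δ a, z ∈ MLR V
    · obtain ⟨z, hz, hzV⟩ := h'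
      obtain ⟨n, hn⟩ : ∃ n, z ∉ V n := by simpa [MLR] using hzV
      exact ⟨n, fun z' hz' _ => Part.mem_unique hz hz' ▸ hn⟩
    · exact ⟨0, fun z hz hzV => absurd ⟨z, hz, hzV⟩ h'⟩
  choose N₀ hN₀ using hlay
  -- These realizers are undefined off the names of random sequences, so convergence of the
  -- reduction shows that its query is such a name.
  let G : (Baire → ℕ) → Baire →. Baire := fun N a =>
    ⟨∃ z ∈ cantorSpace.δ a, z ∈ MLR V, fun _ _ => N a⟩
  have hGN : ∀ N : Baire → ℕ, (∀ a, ∀ z ∈ cantorSpace.δ a, z ∈ MLR V → z ∉ V (N a)) →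
      Realizes (G N) (LAY V) := by
    intro N hN a z hz hzd
    rw [dom_LAY] at hzd
    exact ⟨_, ⟨⟨z, hz, hzd⟩, rfl⟩, N a, Part.mem_some _, hN a z hz hzd⟩
  obtain ⟨_, hq, _⟩ := hG _ (hGN N₀ hN₀) p x hx hxf
  obtain ⟨a, ha, hq⟩ := Part.mem_bind_iff.1 hq
  obtain ⟨_, ⟨⟨z, hz, hzV⟩, _⟩, _⟩ := Part.mem_bind_iff.1 hq
  refine ⟨z, hzV, fun v hv => ?_, fun n hn => ?_⟩
  · obtain ⟨-, rfl⟩ := hz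
    exact (wordLim_of_mono mh (lh p a ha) hv).map fun i => decide (i = 1)
  -- Changing the realizer at the single query `a` shows that the reduction copes with every correct
  -- answer `n`.
  · obtain ⟨c, hc, y, hy, hyf⟩ := hG _ (hGN (Function.update N₀ a n) fun a' z' hz' hzV' => by
      by_cases haa : a' = a
      · subst haa
        rw [Function.update_self, ← Part.mem_unique hz hz']
        exact hn
      · rw [Function.update_of_ne haa]
        exact hN₀ a' z' hz' hzV') p x hx hxf
    obtain ⟨a', ha', hc⟩ := Part.mem_bind_iff.1 hc
    obtain ⟨b, ⟨hd, hb⟩, hc⟩ := Part.mem_bind_iff.1 hc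
    obtain rfl := Part.mem_unique ha ha'
    have hb : (fun _ => n) = b := by
      rw [← hb]
      simp [G]
    subst hb
    exact ⟨c, y, hy, hyf, fun v hv => wordLim_of_mono mk (lk _ c hc) hv⟩

/-- The guess is the pair of layers for the two queries, and the random sequence written is the
query of `g`. The guess for the second query is computed from the guess for the first; it converges
because the first one does. -/
theorem comp_le_LAY {U V W : ℕ → Set Cantor} (hU : IsUniversalMLTest U)
    (hV : IsUniversalMLTest V) (hW : IsUniversalMLTest W) {R S T : RepSpace} {f : Problem S T}
    {g : Problem R S} (hf : Le f (LAY U)) (hg : Le g (LAY V)) : Le (f.comp g) (LAY W) := by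
  obtain ⟨kf, hf, ckf, chf, mkf, mhf, Hf⟩ := exists_wordFun_of_le_LAY hf
  obtain ⟨kg, hg, ckg, chg, mkg, mhg, Hg⟩ := exists_wordFun_of_le_LAY hg
  obtain ⟨u, hu, hUu⟩ := hU.1.1
  obtain ⟨v, hv, hVv⟩ := hV.1.1
  let bits : List ℕ → List Bool := fun w => w.map fun i => decide (i = 1)
  have hbits : Computable bits := (Primrec.list_map Primrec.id
    (Primrec.beq.comp Primrec.snd (Primrec.const 1)).to₂).to_comp
  let h₀ : List ℕ → List Bool := fun w => bits (hg w)
  have hh₀ : Computable h₀ := hbits.comp chg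
  let inner : List ℕ → ℕ → List ℕ := fun w n => kg (interleaveConst w n)
  have hinner : Computable₂ inner := ckg.comp primrec_interleaveConst.to_comp
  let n : List ℕ → ℕ := fun w => layerGuess v w.length (h₀ w)
  have hn : Computable n :=
    (computable_layerGuess hv).comp (g := fun w : List ℕ => (w.length, h₀ w))
      (Computable.list_length.pair hh₀)
  let m : List ℕ → ℕ := fun w => layerGuess u w.length (bits (hf (inner w (n w))))
  have hm : Computable m :=
    (computable_layerGuess hu).comp
      (g := fun w : List ℕ => (w.length, bits (hf (inner w (n w)))))
      (Computable.list_length.pair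
        (hbits.comp (chf.comp (hinner.comp Computable.id hn))))
  let k : ℕ → List ℕ → List ℕ := fun N w =>
    kf (interleaveConst (inner w N.unpair.1) N.unpair.2)
  have hk : Computable₂ k := by
    refine ckf.comp (primrec_interleaveConst.to_comp.comp (hinner.comp Computable.snd ?_) ?_)
    · exact Computable.fst.comp (Computable.unpair.comp Computable.fst)
    · exact Computable.snd.comp (Computable.unpair.comp Computable.fst)
  refine le_LAY_of_limit hW (f.comp g) (h₀ := h₀) (g := fun w => Nat.pair (n w) (m w)) (k := k)
    hh₀ (Primrec₂.natPair.to_comp.comp hn hm) hk (fun v w h => (mhg _ _ h).map _)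
    (fun N v w h => mkf _ _ (interleaveConst_prefix (mkg _ _ (interleaveConst_prefix h _)) _))
    fun p x hx hxd => ?_
  obtain ⟨t, hsub, y₀, hy₀, -⟩ := hxd
  obtain ⟨z, hz, hlz, hans⟩ := Hg p x hx ⟨y₀, hy₀⟩
  have hlz : WordLim (fun s => h₀ (initSeg p s)) z := hlz _ (wordLim_initSeg p)
  obtain ⟨n₀, hn₀, hev⟩ := exists_eventually_layerGuess_eq hVv hlz hz
  obtain ⟨c, y, hcy, hy, hlc⟩ := hans n₀ hn₀
  have hlc : WordLim (fun s => inner (initSeg p s) n₀) c :=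
    hlc _ ((wordLim_initSeg p).interleaveConst n₀)
  -- This uses the domain condition on compositions: whichever value `y` of `g` the answer `n₀`
  -- leads to, `f` is defined at it.
  obtain ⟨z', hz', hlz', hans'⟩ := Hf c y hcy (hsub hy)
  have hevn : ∀ᶠ s in atTop, n (initSeg p s) = n₀ := by
    simpa only [n, length_initSeg] using hev
  have hlz' : WordLim (fun s => bits (hf (inner (initSeg p s) (n (initSeg p s))))) z' := by
    refine (hlz' _ hlc).congr ?_
    filter_upwards [hevn] with s hs
    rw [hs]
  obtain ⟨m₀, hm₀, hev'⟩ := exists_eventually_layerGuess_eq hUu hlz' hz'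
  have hevm : ∀ᶠ s in atTop, m (initSeg p s) = m₀ := by
    simpa only [m, length_initSeg] using hev'
  obtain ⟨d, t', hdt, ht', hld⟩ := hans' m₀ hm₀
  refine ⟨z, MLR_congr hV hW ▸ hz, Nat.pair n₀ m₀, d, t', hdt, ⟨hsub, y, hy, ht'⟩, hlz, ?_, ?_⟩
  · filter_upwards [hevn, hevm] with s h₁ h₂
    rw [h₁, h₂]
  · simpa only [k, Nat.unpair_pair] using hld _ (hlc.interleaveConst m₀)

end Composition

/-! ### Reductions by rearranging names, and products -/

section Reindexing

/-- A reduction whose two computable maps only rearrange the entries of names. -/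
theorem le_of_reindex {X Y Z W : RepSpace} {f : Problem X Y} {g : Problem Z W} {φ ψ : ℕ → ℕ}
    (hφ : Primrec φ) (hφb : ∀ n, φ n ≤ 4 * n + 3) (hψ : Primrec ψ) (hψb : ∀ n, ψ n ≤ 4 * n + 3)
    (H : ∀ p x, x ∈ X.δ p → x ∈ f.dom → ∃ z ∈ Z.δ (fun n => p (φ n)), z ∈ g.dom ∧
      ∀ b, ∀ w ∈ W.δ b, w ∈ g z → ∃ y ∈ Y.δ (fun n => pair p b (ψ n)), y ∈ f x) :
    Le f g := by
  refine ⟨_, _, isComputable_reindex hψ hψb, isComputable_reindex hφ hφb,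
    fun G hG p x hx hxf => ?_⟩
  obtain ⟨z, hz, hzg, h⟩ := H p x hx hxf
  obtain ⟨b, hb, w, hw, hwg⟩ := hG _ z hz hzg
  obtain ⟨y, hy, hyf⟩ := h b w hw hwg
  exact ⟨_, Part.mem_bind_iff.2 ⟨_, Part.mem_some _, Part.mem_bind_iff.2
    ⟨b, hb, Part.mem_some _⟩⟩, y, hy, hyf⟩

theorem mem_prod_δ {X Y : RepSpace} {r : Baire} {x : (X.prod Y).carrier} :
    x ∈ (X.prod Y).δ r ↔ x.1 ∈ X.δ (fst r) ∧ x.2 ∈ Y.δ (snd r) := by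
  refine Part.mem_bind_iff.trans ⟨?_, fun h => ⟨x.1, h.1, (Part.mem_map_iff _).2 ⟨x.2, h.2, rfl⟩⟩⟩
  rintro ⟨a, ha, h⟩
  obtain ⟨b, hb, rfl⟩ := (Part.mem_map_iff _).1 h
  exact ⟨ha, hb⟩

theorem primrec_two_mul : Primrec fun n => 2 * n :=
  Primrec.nat_mul.comp (Primrec.const 2) Primrec.id

theorem primrec_two_mul_add_one : Primrec fun n => 2 * n + 1 := Primrec.succ.comp primrec_two_mul

theorem primrec_ite_even {φ ψ : ℕ → ℕ} (hφ : Primrec φ) (hψ : Primrec ψ) :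
    Primrec fun n => if n % 2 = 0 then φ n else ψ n :=
  Primrec.ite (Primrec.eq.comp (Primrec.nat_mod.comp Primrec.id (Primrec.const 2))
    (Primrec.const 0)) hφ hψ

theorem le_refl {X Y : RepSpace} (f : Problem X Y) : Le f f :=
  le_of_reindex Primrec.id (fun n => by simp; omega) primrec_two_mul_add_one
    (fun n => by omega) fun p x hx hxf => ⟨x, hx, hxf, fun b y hy hyf =>
      ⟨y, by rw [show (fun n => pair p b (2 * n + 1)) = b from snd_pair p b]; exact hy, hyf⟩⟩

/-- The identity of the set of random sequences. -/
def randomId (U : ℕ → Set Cantor) : Problem cantorSpace cantorSpace :=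
  fun z => {z' | z' = z ∧ z ∈ MLR U}

/-- The answer of `LAY U` is ignored and the instance returned. -/
theorem randomId_le_LAY (U : ℕ → Set Cantor) : Le (randomId U) (LAY U) :=
  le_of_reindex Primrec.id (fun n => by simp; omega) primrec_two_mul (fun n => by omega)
    fun p z hz hzd => by
      obtain ⟨_, rfl, hzU⟩ := hzd
      refine ⟨_, hz, by rwa [dom_LAY], fun b _ _ _ => ⟨_, ?_, rfl, hzU⟩⟩
      rw [show (fun n => pair p b (2 * n)) = p from fst_pair p b]
      exact hz

theorem LAY_comp_randomId {U V : ℕ → Set Cantor} (h : MLR U = MLR V) :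
    (LAY U).comp (randomId V) = LAY U := by
  funext z
  ext n
  constructor
  · rintro ⟨-, _, ⟨rfl, -⟩, hn⟩
    exact hn
  · intro hn
    have hz : z ∈ MLR U := by rw [← dom_LAY]; exact ⟨n, hn⟩
    refine ⟨?_, z, ⟨rfl, h ▸ hz⟩, hn⟩
    rintro _ ⟨rfl, -⟩
    exact ⟨n, hn⟩

/-- Independence of the test comes for free: `LAY U` is a composition of two problems below `LAY U`,
and the target test in `comp_le_LAY` is arbitrary. -/
theorem LAY_le_LAY {U V : ℕ → Set Cantor} (hU : IsUniversalMLTest U)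
    (hV : IsUniversalMLTest V) : Le (LAY U) (LAY V) := by
  rw [← LAY_comp_randomId (U := U) rfl]
  exact comp_le_LAY hU hU hV (le_refl _) (randomId_le_LAY U)

/-- The problem `id × g` on pairs whose first component is arbitrary. -/
def idProd (X : RepSpace) {Z W : RepSpace} (g : Problem Z W) :
    Problem (X.prod Z) (X.prod W) := fun x => {x.1} ×ˢ g x.2

/-- The problem `f × id` on pairs whose second component is arbitrary. -/
def prodId {X Y : RepSpace} (f : Problem X Y) (W : RepSpace) :
    Problem (X.prod W) (Y.prod W) := fun x => f x.1 ×ˢ {x.2}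

/-- This turns a product into a composition: the second component is solved while the first is
carried along, then conversely. -/
theorem prodId_comp_idProd {X Y Z W : RepSpace} (f : Problem X Y) (g : Problem Z W) :
    (prodId f W).comp (idProd X g) = f.prod g := by
  funext x
  ext y
  constructor
  · rintro ⟨-, ⟨a, b⟩, ⟨ha, hb⟩, hy, hy'⟩
    cases ha
    cases hy'
    exact ⟨hy, hb⟩
  · rintro ⟨h₁, h₂⟩
    refine ⟨?_, (x.1, y.2), ⟨rfl, h₂⟩, h₁, rfl⟩
    rintro ⟨a, b⟩ ⟨ha, -⟩
    cases ha
    exact ⟨(y.1, b), h₁, rfl⟩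

theorem idProd_le (X : RepSpace) {Z W : RepSpace} (g : Problem Z W) : Le (idProd X g) g := by
  -- In `⟨p, b⟩`, entry `n` of `fst p` sits at place `4 * n`, and entry `n` of `b` at place `2 * n +
  -- 1`.
  refine le_of_reindex (φ := fun n => 2 * n + 1)
    (ψ := fun n => if n % 2 = 0 then 2 * n else n) primrec_two_mul_add_one (fun n => by omega)
    (primrec_ite_even primrec_two_mul Primrec.id)
    (fun n => by split_ifs <;> omega) ?_
  rintro p x hx ⟨y, -, hy⟩
  rw [mem_prod_δ] at hx
  refine ⟨x.2, hx.2, ⟨_, hy⟩, fun b w hw hwg => ⟨(x.1, w), ?_, rfl, hwg⟩⟩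
  refine mem_prod_δ.2 ?_
  have h₁ : fst (fun n => pair p b (if n % 2 = 0 then 2 * n else n)) = fst p := by
    funext n
    have h := congrFun (fst_pair p b) (2 * n)
    simp only [fst] at h ⊢
    rw [if_pos (by omega), h]
  have h₂ : snd (fun n => pair p b (if n % 2 = 0 then 2 * n else n)) = b := by
    funext n
    have h := congrFun (snd_pair p b) n
    simp only [snd] at h ⊢
    rw [if_neg (by omega), h]
  rw [h₁, h₂]
  exact ⟨hx.1, hw⟩

theorem prodId_le {X Y : RepSpace} (f : Problem X Y) (W : RepSpace) : Le (prodId f W) f := by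
  refine le_of_reindex (φ := fun n => 2 * n)
    (ψ := fun n => if n % 2 = 0 then n + 1 else 2 * n) primrec_two_mul (fun n => by omega)
    (primrec_ite_even Primrec.succ primrec_two_mul)
    (fun n => by split_ifs <;> omega) ?_
  rintro p x hx ⟨y, hy, -⟩
  rw [mem_prod_δ] at hx
  refine ⟨x.1, hx.1, ⟨_, hy⟩, fun b w hw hwf => ⟨(w, x.2), ?_, hwf, rfl⟩⟩
  refine mem_prod_δ.2 ?_
  have h₁ : fst (fun n => pair p b (if n % 2 = 0 then n + 1 else 2 * n)) = b := by
    funext n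
    have h := congrFun (snd_pair p b) n
    simp only [fst, snd] at h ⊢
    rw [if_pos (by omega), h]
  have h₂ : snd (fun n => pair p b (if n % 2 = 0 then n + 1 else 2 * n)) = snd p := by
    funext n
    have h := congrFun (fst_pair p b) (2 * n + 1)
    simp only [fst, snd] at h ⊢
    rw [if_neg (by omega), h]
  rw [h₁, h₂]
  exact ⟨hw, hx.2⟩

/-- Both factors are asked the same question, and the second answer is dropped; the inclusion of
domains guarantees that it exists. -/
theorem le_prod_of_le {X Y Z S T : RepSpace} {e : Problem S T} {f : Problem X Y}
    {g : Problem X Z} (hfg : f.dom ⊆ g.dom) (h : Le e f) : Le e (f.prod g) := by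
  obtain ⟨K, H, hK, hH, h⟩ := h
  have hdiag : IsComputable fun p => Part.some fun n => p (n / 2) :=
    isComputable_reindex (Primrec.nat_div.comp Primrec.id (Primrec.const 2)) fun n => by omega
  -- This map takes `⟨p, b⟩` to `⟨p, fst b⟩`: for odd `n`, the required entry `b (n - 1)` sits at
  -- place `2 * n - 1`.
  have hfst : IsComputable fun r =>
      Part.some fun n => r (if n % 2 = 0 then n else 2 * n - 1) :=
    isComputable_reindex (primrec_ite_even Primrec.id (Primrec.pred.comp primrec_two_mul))
      fun n => by split_ifs <;> omega
  refine ⟨_, _, hfst.bind hK, hH.bind hdiag, fun G hG p x hx hxe => ?_⟩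
  have hpair : ∀ a : Baire, (fun n => a (n / 2)) = pair a a := fun a => by
    funext n
    simp [pair]
  have hreal : Realizes (fun a => (G (pair a a)).map fst) f := by
    intro a y hy hyf
    have hdom : (y, y) ∈ (f.prod g).dom := by
      obtain ⟨u, hu⟩ := hyf
      obtain ⟨v, hv⟩ := hfg ⟨u, hu⟩
      exact ⟨(u, v), hu, hv⟩
    have hyy : (y, y) ∈ (X.prod X).δ (pair a a) :=
      mem_prod_δ.2 ⟨by rwa [fst_pair], by rwa [snd_pair]⟩
    obtain ⟨b, hb, u, hu, hfu⟩ := hG _ _ hyy hdom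
    exact ⟨fst b, (Part.mem_map_iff _).2 ⟨b, hb, rfl⟩, u.1, (mem_prod_δ.1 hu).1, hfu.1⟩
  obtain ⟨q, hq, t, ht⟩ := h _ hreal p x hx hxe
  obtain ⟨a, ha, hq⟩ := Part.mem_bind_iff.1 hq
  obtain ⟨b', hb', hq⟩ := Part.mem_bind_iff.1 hq
  obtain ⟨b, hb, rfl⟩ := (Part.mem_map_iff _).1 hb'
  refine ⟨q, Part.mem_bind_iff.2 ⟨pair a a, Part.mem_bind_iff.2 ⟨a, ha, ?_⟩,
    Part.mem_bind_iff.2 ⟨b, hb, Part.mem_bind_iff.2 ⟨pair p (fst b), ?_, hq⟩⟩⟩, t, ht⟩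
  · exact Part.mem_some_iff.2 (hpair a).symm
  · refine Part.mem_some_iff.2 (funext fun n => ?_)
    split_ifs with hn
    · simp [pair, hn]
    · have h₁ : (2 * n - 1) % 2 ≠ 0 := by omega
      have h₂ : (2 * n - 1) / 2 = 2 * (n / 2) := by omega
      simp [pair, hn, h₁, h₂, fst]

end Reindexing

end Weihrauch

/-! ### The product and the compositional product -/

theorem corollary8 (U V W : ℕ → Set Weihrauch.Cantor)
    (hU : Weihrauch.IsUniversalMLTest U) (hV : Weihrauch.IsUniversalMLTest V)
    (hW : Weihrauch.IsUniversalMLTest W) :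
    Weihrauch.Equivalent ((Weihrauch.LAY U).prod (Weihrauch.LAY V)) (Weihrauch.LAY W) ∧
      Weihrauch.IsCompProd (Weihrauch.LAY U) (Weihrauch.LAY V) (Weihrauch.LAY W) := by
  refine ⟨⟨?_, ?_⟩, ?_, fun R S T f₀ g₀ hf hg => Weihrauch.comp_le_LAY hU hV hW hf hg⟩
  · rw [← Weihrauch.prodId_comp_idProd]
    exact Weihrauch.comp_le_LAY hU hV hW (Weihrauch.prodId_le _ _) (Weihrauch.idProd_le _ _)
  · refine Weihrauch.le_prod_of_le ?_ (Weihrauch.LAY_le_LAY hW hU)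
    rw [Weihrauch.dom_LAY, Weihrauch.dom_LAY, Weihrauch.MLR_congr hU hV]
  -- The maximum is attained by `LAY W` after the identity on random sequences.
  · refine ⟨_, _, _, Weihrauch.LAY W, Weihrauch.randomId V, Weihrauch.LAY_le_LAY hW hU,
      Weihrauch.randomId_le_LAY V, ?_⟩
    rw [Weihrauch.LAY_comp_randomId (Weihrauch.MLR_congr hW hV)]
    exact ⟨Weihrauch.le_refl _, Weihrauch.le_refl _⟩
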